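/- Let $\Bbbk$ be a field, $R=\Bbbk[x_0,\dots,x_n]$, $\mathfrak m=(x_0,\dots,x_n)$, and let $I\subseteq R$ be a monomial ideal, i.e. an ideal generated by monomials. Let $\operatorname{Ass}(I)$ be the set of associated primes of $R/I$. For $m\ge 0$ let $$I^{(m)}=\bigcap_{P\in\operatorname{Ass}(I)}\bigl(R\cap I^mR_P\bigr)$$ be the $m$-th symbolic power of $I$, where $R\cap I^mR_P$ is the preimage of $I^mR_P$ in $R$. Let $e$ be the big-height of $I$, i.e. the maximum of the heights of the primes in $\operatorname{Ass}(I)$, and let $\sigma(I)$ be the minimum, over all monomials $x^a\in I$, of the number of variables that divide $x^a$ (by convention $e=0$ if $I=R$, and $\sigma(I)=0$ if $I=0$). Then for every integer $r\ge 1$, $$I^{(r+e)}\subseteq \mathfrak m^{\sigma(I)}\,I^{(r)}.$$ -/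

import Mathlib

namespace SymbolicPowers

noncomputable section

/-- The symbolic power `I^(m) = ⋂_{P ∈ Ass(R/I)} (R ∩ I^m R_P)`, where `R ∩ -` is the contraction
along the localization map `R → R_P`. -/
def symbolicPower {R : Type*} [CommRing R] (I : Ideal R) (m : ℕ) : Ideal R :=
  ⨅ P : PrimeSpectrum R, ⨅ _ : P.asIdeal ∈ associatedPrimes R (R ⧸ I),
    ((I ^ m).map (algebraMap R (Localization.AtPrime P.asIdeal))).comap
      (algebraMap R (Localization.AtPrime P.asIdeal))

/-- The big-height of `I`: the supremum of the heights of the associated primes of `R/I`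
(a maximum when `R` is Noetherian and `I` is proper). -/
def bigHeight {R : Type*} [CommRing R] (I : Ideal R) : ℕ∞ :=
  ⨆ P ∈ associatedPrimes R (R ⧸ I), P.height

/-- An ideal of a polynomial ring generated by monomials. -/
def IsMonomialIdeal {k ι : Type*} [Field k] (I : Ideal (MvPolynomial ι k)) : Prop :=
  ∃ S : Set (ι →₀ ℕ), I = Ideal.span ((fun a => MvPolynomial.monomial a (1 : k)) '' S)

/-- The minimal number of variables in the support of a monomial of `I`
(with value `0` if `I` contains no monomial). -/
def minSupport {k ι : Type*} [Field k] (I : Ideal (MvPolynomial ι k)) : ℕ :=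
  sInf {c : ℕ | ∃ a : ι →₀ ℕ, MvPolynomial.monomial a (1 : k) ∈ I ∧ a.support.card = c}

/-- The ideal generated by all the variables. -/
def irrelevantIdeal (k ι : Type*) [Field k] : Ideal (MvPolynomial ι k) :=
  Ideal.span (Set.range MvPolynomial.X)

end

end SymbolicPowers

open MvPolynomial

namespace SymbolicPowers

/-! ### Symbolic powers as contractions from localizations -/

section Contraction

variable {R : Type*} [CommRing R]

/-! Symbolic powers of a monomial ideal can be tested on monomials. Let `x^a` be a monomial of
`I^(r+e)` and divide it by each of its variables once. At an associated prime `P`, some monomial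
prime to the variables in `P` multiplies `x^a` into `I^(r+e)` (ordinary power). At most `height P ≤
e` variables lie in `P` (`card_le_height`), and lowering an exponent by one costs at most one factor
of `I` (`monomial_sub_single_mem_pow`). The variables outside `P` are units at `P`, so losing them
costs nothing. Hence the quotient is in `I^(r)`. The divisor has degree `a.support.card`, which is
at least `σ(I)` because `x^a ∈ I`. -/

lemma mem_comap_map_localization_iff (J P : Ideal R) [P.IsPrime] (f : R) :
    f ∈ (J.map (algebraMap R (Localization.AtPrime P))).comap
      (algebraMap R (Localization.AtPrime P)) ↔ ∃ s ∉ P, s * f ∈ J := by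
  rw [Ideal.mem_comap, IsLocalization.algebraMap_mem_map_algebraMap_iff P.primeCompl]
  rfl

lemma mem_symbolicPower_iff (I : Ideal R) (m : ℕ) (f : R) :
    f ∈ symbolicPower I m ↔
      ∀ P ∈ associatedPrimes R (R ⧸ I), ∃ s ∉ P, s * f ∈ I ^ m := by
  simp only [symbolicPower, Ideal.mem_iInf, mem_comap_map_localization_iff]
  exact ⟨fun h P hP => h ⟨P, hP.isPrime⟩ hP, fun h P hP => h P.asIdeal hP⟩

lemma symbolicPower_antitone (I : Ideal R) : Antitone (symbolicPower I) := by
  intro m n hmn f hf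
  rw [mem_symbolicPower_iff] at hf ⊢
  intro P hP
  obtain ⟨s, hs, hsf⟩ := hf P hP
  exact ⟨s, hs, Ideal.pow_le_pow_right hmn hsf⟩

/-- The annihilator of a nonzero class in `R/I` lies in some associated prime, so no multiplier
outside that prime can kill the class. -/
lemma symbolicPower_one_le [IsNoetherianRing R] (I : Ideal R) : symbolicPower I 1 ≤ I := by
  intro f hf
  rw [mem_symbolicPower_iff] at hf
  by_contra hfI
  have hne : Ideal.Quotient.mk I f ≠ 0 := fun h => hfI (Ideal.Quotient.eq_zero_iff_mem.mp h)
  obtain ⟨P, hP, hle⟩ := exists_le_isAssociatedPrime_of_isNoetherianRing R _ hne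
  obtain ⟨s, hs, hsf⟩ := hf P hP
  refine hs (hle ?_)
  rw [Submodule.mem_colon_singleton, Submodule.mem_bot, Algebra.smul_def]
  exact Ideal.Quotient.eq_zero_iff_mem.mpr (by simpa using hsf)

end Contraction

variable {k ι : Type*} [Field k]

/-! ### Monomial ideals and their powers -/

section MonomialIdeal

lemma IsMonomialIdeal.mem_iff {J : Ideal (MvPolynomial ι k)} (hJ : IsMonomialIdeal J)
    {f : MvPolynomial ι k} : f ∈ J ↔ ∀ a ∈ f.support, monomial a (1 : k) ∈ J := by
  classical
  obtain ⟨S, rfl⟩ := hJ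
  simp only [mem_ideal_span_monomial_image]
  refine forall₂_congr fun a _ => ?_
  simp [support_monomial]

lemma isMonomialIdeal_top : IsMonomialIdeal (⊤ : Ideal (MvPolynomial ι k)) := by
  refine ⟨{0}, ?_⟩
  rw [Set.image_singleton, eq_comm, Ideal.span_singleton_eq_top]
  exact isUnit_one

lemma span_monomial_mul_span_monomial (S T : Set (ι →₀ ℕ)) :
    Ideal.span ((fun a => monomial a (1 : k)) '' S) *
      Ideal.span ((fun a => monomial a (1 : k)) '' T) =
      Ideal.span ((fun a => monomial a (1 : k)) '' Set.image2 (· + ·) S T) := by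
  rw [Ideal.span_mul_span', ← Set.image2_mul, Set.image2_image_left, Set.image2_image_right,
    Set.image_image2]
  simp [monomial_mul]

lemma IsMonomialIdeal.mul {I J : Ideal (MvPolynomial ι k)} (hI : IsMonomialIdeal I)
    (hJ : IsMonomialIdeal J) : IsMonomialIdeal (I * J) := by
  obtain ⟨S, rfl⟩ := hI
  obtain ⟨T, rfl⟩ := hJ
  exact ⟨Set.image2 (· + ·) S T, span_monomial_mul_span_monomial S T⟩

lemma IsMonomialIdeal.pow {I : Ideal (MvPolynomial ι k)} (hI : IsMonomialIdeal I) (m : ℕ) :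
    IsMonomialIdeal (I ^ m) := by
  induction m with
  | zero => simpa [Ideal.one_eq_top] using isMonomialIdeal_top
  | succ m ih => simpa [pow_succ] using ih.mul hI

lemma monomial_mem_of_le {J : Ideal (MvPolynomial ι k)} {a b : ι →₀ ℕ} (hab : a ≤ b)
    (ha : monomial a (1 : k) ∈ J) : monomial b (1 : k) ∈ J := by
  have h : monomial b (1 : k) = monomial (b - a) 1 * monomial a 1 := by
    rw [monomial_mul, tsub_add_cancel_of_le hab, one_mul]
  exact h ▸ J.mul_mem_left _ ha

lemma IsMonomialIdeal.exists_add_le_of_mem_mul {I J : Ideal (MvPolynomial ι k)}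
    (hI : IsMonomialIdeal I) (hJ : IsMonomialIdeal J) {v : ι →₀ ℕ}
    (hv : monomial v (1 : k) ∈ I * J) :
    ∃ g h : ι →₀ ℕ, monomial g (1 : k) ∈ I ∧ monomial h (1 : k) ∈ J ∧ g + h ≤ v := by
  classical
  obtain ⟨S, rfl⟩ := hI
  obtain ⟨T, rfl⟩ := hJ
  rw [span_monomial_mul_span_monomial, mem_ideal_span_monomial_image] at hv
  obtain ⟨_, ⟨g, hg, h, hh, rfl⟩, hle⟩ := hv v (by simp [support_monomial])
  exact ⟨g, h, Ideal.subset_span ⟨g, hg, rfl⟩, Ideal.subset_span ⟨h, hh, rfl⟩, hle⟩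

/-- Lowering one exponent by one costs at most one factor in a power of a monomial ideal. -/
lemma IsMonomialIdeal.monomial_sub_single_mem_pow {I : Ideal (MvPolynomial ι k)}
    (hI : IsMonomialIdeal I) (i : ι) (m : ℕ) {v : ι →₀ ℕ}
    (hv : monomial v (1 : k) ∈ I ^ (m + 1)) :
    monomial (v - Finsupp.single i 1) (1 : k) ∈ I ^ m := by
  classical
  induction m generalizing v with
  | zero => simp [Ideal.one_eq_top]
  | succ m ih =>
    rw [pow_succ] at hv
    obtain ⟨g, h, hg, hh, hle⟩ := (hI.pow (m + 1)).exists_add_le_of_mem_mul hI hv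
    -- Either `x_i` does not divide the factor `h ∈ I` and the exponent is lowered in `g`, or the
    -- whole factor `h` is given up.
    by_cases hi : h i = 0
    · have hmem : monomial ((g - Finsupp.single i 1) + h) (1 : k) ∈ I ^ (m + 1) := by
        rw [pow_succ, ← one_mul (1 : k), ← monomial_mul]
        exact Ideal.mul_mem_mul (ih hg) hh
      refine monomial_mem_of_le (fun j => ?_) hmem
      have hj := hle j
      by_cases hij : i = j
      · subst hij
        simp only [Finsupp.add_apply, Finsupp.tsub_apply, Finsupp.single_eq_same, hi] at hj ⊢
        omega
      · simpa [Finsupp.single_apply, hij] using hj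
    · refine monomial_mem_of_le (fun j => ?_) hg
      have hj := hle j
      by_cases hij : i = j
      · subst hij
        simp only [Finsupp.add_apply, Finsupp.tsub_apply, Finsupp.single_eq_same] at hj ⊢
        omega
      · simp only [Finsupp.add_apply, Finsupp.tsub_apply, Finsupp.single_apply, hij,
          if_false] at hj ⊢
        omega

lemma IsMonomialIdeal.monomial_sub_sum_single_mem_pow {I : Ideal (MvPolynomial ι k)}
    (hI : IsMonomialIdeal I) (m : ℕ) (T : Finset ι) {v : ι →₀ ℕ}
    (hv : monomial v (1 : k) ∈ I ^ (m + T.card)) :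
    monomial (v - ∑ i ∈ T, Finsupp.single i 1) (1 : k) ∈ I ^ m := by
  classical
  induction T using Finset.induction_on generalizing v with
  | empty => simpa using hv
  | insert i T hi ih =>
    rw [Finset.card_insert_of_notMem hi, ← add_assoc] at hv
    rw [Finset.sum_insert hi, ← tsub_tsub]
    exact ih (hI.monomial_sub_single_mem_pow i _ hv)

/-- If a polynomial having a term prime to the variables in `F` multiplies `f` into a monomial
ideal, then each term of `f` is multiplied into that ideal by a monomial prime to `F`. -/
lemma IsMonomialIdeal.exists_monomial_mul_mem [LinearOrder ι] {J : Ideal (MvPolynomial ι k)}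
    (hJ : IsMonomialIdeal J) (F : Finset ι) {s f : MvPolynomial ι k} (hsf : s * f ∈ J)
    (hs : ∃ u ∈ s.support, ∀ i ∈ F, u i = 0) {a : ι →₀ ℕ} (ha : a ∈ f.support) :
    ∃ u : ι →₀ ℕ, (∀ i ∈ F, u i = 0) ∧ monomial (u + a) (1 : k) ∈ J := by
  classical
  let K : (ι →₀ ℕ) → Prop := fun a =>
    ∃ u : ι →₀ ℕ, (∀ i ∈ F, u i = 0) ∧ monomial (u + a) (1 : k) ∈ J
  have hK : ∀ b c, K b → K (c + b) := by
    rintro b c ⟨u, hu, hub⟩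
    refine ⟨u, hu, monomial_mem_of_le ?_ hub⟩
    exact add_le_add_right (le_add_of_nonneg_left zero_le) u
  -- Comparing degree in `F` first makes the `φ`-minimal term of `s` prime to `F`; the lexicographic
  -- tie-break makes `φ` injective.
  let φ : (ι →₀ ℕ) → ℕ ×ₗ Lex (ι →₀ ℕ) := fun a => toLex (∑ i ∈ F, a i, toLex a)
  have φ_add : ∀ b c, φ (b + c) = φ b + φ c := fun b c => by
    simp only [φ, Finsupp.add_apply, Finset.sum_add_distrib]
    rfl
  have φ_inj : Function.Injective φ := fun b c h =>
    toLex.injective (congrArg Prod.snd (toLex.injective h))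
  change K a
  by_contra haK
  obtain ⟨b, hb, hbmin⟩ := (f.support.filter fun c => ¬ K c).exists_min_image φ
    ⟨a, Finset.mem_filter.mpr ⟨ha, haK⟩⟩
  obtain ⟨u₀, hu₀s, hu₀⟩ := hs
  obtain ⟨u, hu, humin⟩ := s.support.exists_min_image φ ⟨u₀, hu₀s⟩
  obtain ⟨hbf, hbK⟩ := Finset.mem_filter.mp hb
  have huF : ∀ i ∈ F, u i = 0 := by
    have h1 : ∑ i ∈ F, u i ≤ ∑ i ∈ F, u₀ i := by
      rcases Prod.Lex.le_iff.mp (humin u₀ hu₀s) with h | h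
      exacts [h.le, h.1.le]
    rw [Finset.sum_eq_zero hu₀, Nat.le_zero, Finset.sum_eq_zero_iff] at h1
    exact h1
  -- No other pair contributes to the coefficient at `u + b`: a term `b'` of `f` satisfying `K`
  -- would force `K b`, and otherwise minimality of `u` and `b` forces equality.
  have huniq : ∀ p ∈ Finset.HasAntidiagonal.antidiagonal (u + b), p ≠ (u, b) →
      coeff p.1 s * coeff p.2 f = 0 := by
    rintro ⟨u', b'⟩ hp hne
    rw [Finset.HasAntidiagonal.mem_antidiagonal] at hp
    by_contra hmul
    have hu' : u' ∈ s.support := mem_support_iff.mpr (left_ne_zero_of_mul hmul)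
    have hb' : b' ∈ f.support := mem_support_iff.mpr (right_ne_zero_of_mul hmul)
    have hb'K : ¬ K b' := fun h => by
      obtain ⟨w, hw, hwJ⟩ := hK b' u' h
      refine hbK ⟨w + u, fun i hi => by simp [hw i hi, huF i hi], ?_⟩
      rwa [add_assoc, ← hp]
    have h1 := humin u' hu'
    have h2 := hbmin b' (Finset.mem_filter.mpr ⟨hb', hb'K⟩)
    have h3 : φ u' + φ b' = φ u + φ b := by rw [← φ_add, ← φ_add]; exact congrArg φ hp
    have h4 := (add_eq_add_iff_eq_and_eq h1 h2).mp h3.symm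
    exact hne (Prod.ext (φ_inj h4.1.symm) (φ_inj h4.2.symm))
  have hcoeff : coeff (u + b) (s * f) = coeff u s * coeff b f := by
    rw [coeff_mul]
    refine Finset.sum_eq_single (u, b) huniq fun h => absurd ?_ h
    rw [Finset.HasAntidiagonal.mem_antidiagonal]
  refine hbK ⟨u, huF, hJ.mem_iff.mp hsf _ (mem_support_iff.mpr ?_)⟩
  rw [hcoeff]
  exact mul_ne_zero (mem_support_iff.mp hu) (mem_support_iff.mp hbf)

lemma monomial_sum_single_mem_irrelevantIdeal_pow (T : Finset ι) :
    monomial (∑ i ∈ T, Finsupp.single i 1) (1 : k) ∈ irrelevantIdeal k ι ^ T.card := by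
  classical
  induction T using Finset.induction_on with
  | empty => simp [Ideal.one_eq_top]
  | insert i T hi ih =>
    rw [Finset.sum_insert hi, Finset.card_insert_of_notMem hi, pow_succ', ← one_mul (1 : k),
      ← monomial_mul]
    exact Ideal.mul_mem_mul (Ideal.subset_span ⟨i, rfl⟩) ih

end MonomialIdeal

/-! ### Variables contained in a prime -/

section Primes

lemma monomial_mem_of_X_mem {P : Ideal (MvPolynomial ι k)} {i : ι} (hi : X i ∈ P)
    {u : ι →₀ ℕ} (hu : u i ≠ 0) : monomial u (1 : k) ∈ P :=
  monomial_mem_of_le (a := Finsupp.single i 1)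
    (Finsupp.single_le_iff.mpr (Nat.one_le_iff_ne_zero.mpr hu)) hi

lemma exists_mem_support_of_notMem {P : Ideal (MvPolynomial ι k)} {s : MvPolynomial ι k}
    (hs : s ∉ P) (F : Finset ι) (hF : ∀ i ∈ F, X i ∈ P) :
    ∃ u ∈ s.support, ∀ i ∈ F, u i = 0 := by
  by_contra! h
  refine hs ?_
  rw [s.as_sum]
  refine P.sum_mem fun u hu => ?_
  obtain ⟨i, hi, hui⟩ := h u hu
  rw [← mul_one (coeff u s), ← C_mul_monomial]
  exact P.mul_mem_left _ (monomial_mem_of_X_mem (hF i hi) hui)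

lemma monomial_notMem_of_forall {P : Ideal (MvPolynomial ι k)} [hP : P.IsPrime]
    {u : ι →₀ ℕ} (hu : ∀ i, X i ∈ P → u i = 0) : monomial u (1 : k) ∉ P := by
  rw [monomial_eq, C_1, one_mul, Finsupp.prod, hP.prod_mem_iff]
  rintro ⟨i, hi, hiP⟩
  exact Finsupp.mem_support_iff.mp hi (hu i (hP.mem_of_pow_mem _ hiP))

open Classical in
/-- The endomorphism of the polynomial ring that sends the variables in `F` to zero. -/
noncomputable def killVars (k : Type*) {ι : Type*} [Field k] (F : Finset ι) :
    MvPolynomial ι k →ₐ[k] MvPolynomial ι k :=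
  aeval fun i => if i ∈ F then 0 else X i

/-- Modulo `P`, killing variables that already lie in `P` changes nothing. -/
lemma ker_killVars_le (F : Finset ι) (P : Ideal (MvPolynomial ι k)) (hF : ∀ i ∈ F, X i ∈ P) :
    RingHom.ker (killVars k F) ≤ P := by
  classical
  have h : (Ideal.Quotient.mkₐ k P).comp (killVars k F) = Ideal.Quotient.mkₐ k P := by
    ext i
    by_cases hi : i ∈ F
    · simpa [killVars, hi] using (Ideal.Quotient.eq_zero_iff_mem.mpr (hF i hi)).symm
    · simp [killVars, hi]
  intro f hf
  have h2 := DFunLike.congr_fun h f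
  rw [AlgHom.comp_apply, (RingHom.mem_ker).mp hf, map_zero] at h2
  exact Ideal.Quotient.eq_zero_iff_mem.mp h2.symm

lemma X_mem_ker_killVars_iff (F : Finset ι) (i : ι) :
    X i ∈ RingHom.ker (killVars k F) ↔ i ∈ F := by
  simp [killVars, RingHom.mem_ker]

/-- The kernels of `killVars` are prime, since the target is a domain, and grow strictly with each
variable added. -/
lemma card_le_height (F : Finset ι) (P : Ideal (MvPolynomial ι k)) (hF : ∀ i ∈ F, X i ∈ P) :
    (F.card : ℕ∞) ≤ P.height := by
  classical
  refine le_trans ?_ (Ideal.height_mono (ker_killVars_le F P hF))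
  clear hF P
  induction F using Finset.induction_on with
  | empty => simp
  | insert i F hi ih =>
    have hlt : RingHom.ker (killVars k F) < RingHom.ker (killVars k (insert i F)) := by
      refine lt_of_le_of_ne (ker_killVars_le _ _ fun j hj => ?_) fun h => hi ?_
      · exact (X_mem_ker_killVars_iff _ _).mpr (Finset.mem_insert_of_mem hj)
      · rw [← X_mem_ker_killVars_iff (k := k), h, X_mem_ker_killVars_iff]
        exact Finset.mem_insert_self _ _
    have := RingHom.ker_isPrime (killVars k F)
    have := RingHom.ker_isPrime (killVars k (insert i F))
    rw [Finset.card_insert_of_notMem hi, Nat.cast_succ]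
    exact (add_le_add_left ih 1).trans (Ideal.height_add_one_le_of_lt_of_isPrime hlt)

end Primes

/-! ### Symbolic powers of monomial ideals -/

section SymbolicPower

variable [Finite ι] {I : Ideal (MvPolynomial ι k)}

/-- Membership of a monomial ideal's symbolic power can be tested on terms, with monomial
multipliers. -/
lemma IsMonomialIdeal.exists_monomial_mul_mem_pow [LinearOrder ι] (hI : IsMonomialIdeal I)
    {m : ℕ} {f : MvPolynomial ι k} (hf : f ∈ symbolicPower I m) {a : ι →₀ ℕ}
    (ha : a ∈ f.support) {P : Ideal (MvPolynomial ι k)}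
    (hP : P ∈ associatedPrimes (MvPolynomial ι k) (MvPolynomial ι k ⧸ I)) :
    ∃ u : ι →₀ ℕ, (∀ i, X i ∈ P → u i = 0) ∧ monomial (u + a) (1 : k) ∈ I ^ m := by
  classical
  have := Fintype.ofFinite ι
  obtain ⟨s, hs, hsf⟩ := (mem_symbolicPower_iff I m f).mp hf P hP
  let F : Finset ι := Finset.univ.filter fun i => X i ∈ P
  obtain ⟨u, hu, hua⟩ := (hI.pow m).exists_monomial_mul_mem F hsf
    (exists_mem_support_of_notMem hs F fun i hi => (Finset.mem_filter.mp hi).2) ha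
  exact ⟨u, fun i hi => hu i (Finset.mem_filter.mpr ⟨Finset.mem_univ i, hi⟩), hua⟩

lemma IsMonomialIdeal.monomial_mem_symbolicPower [LinearOrder ι] (hI : IsMonomialIdeal I)
    {m : ℕ} {f : MvPolynomial ι k} (hf : f ∈ symbolicPower I m) {a : ι →₀ ℕ}
    (ha : a ∈ f.support) : monomial a (1 : k) ∈ symbolicPower I m := by
  rw [mem_symbolicPower_iff]
  intro P hP
  have := hP.isPrime
  obtain ⟨u, hu, hua⟩ := hI.exists_monomial_mul_mem_pow hf ha hP
  refine ⟨monomial u 1, monomial_notMem_of_forall hu, ?_⟩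
  rwa [monomial_mul, one_mul]

/-- Dividing a monomial of `I^(r+e)` by each of its variables once gives a monomial of `I^(r)`. -/
lemma IsMonomialIdeal.monomial_sub_support_mem_symbolicPower [LinearOrder ι]
    (hI : IsMonomialIdeal I) {e : ℕ} (he : bigHeight I ≤ (e : ℕ∞)) {r : ℕ} {a : ι →₀ ℕ}
    (ha : monomial a (1 : k) ∈ symbolicPower I (r + e)) :
    monomial (a - ∑ i ∈ a.support, Finsupp.single i 1) (1 : k) ∈ symbolicPower I r := by
  classical
  rw [mem_symbolicPower_iff]
  intro P hP
  have := hP.isPrime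
  obtain ⟨u, hu, hua⟩ := hI.exists_monomial_mul_mem_pow (a := a) ha
    (by simp [support_monomial]) hP
  -- Variables in `T` are paid for by the `e` spare factors; those in `U` lie outside `P` and are
  -- restored by the multiplier.
  let T : Finset ι := a.support.filter fun i => X i ∈ P
  let U : Finset ι := a.support.filter fun i => X i ∉ P
  have hT : T.card ≤ e := by
    have h1 := card_le_height T P fun i hi => (Finset.mem_filter.mp hi).2
    have h2 : P.height ≤ bigHeight I :=
      le_iSup₂ (f := fun (P : Ideal (MvPolynomial ι k))
        (_ : P ∈ associatedPrimes (MvPolynomial ι k) (MvPolynomial ι k ⧸ I)) => P.height) P hP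
    exact_mod_cast h1.trans (h2.trans he)
  have hmem := hI.monomial_sub_sum_single_mem_pow r T
    (Ideal.pow_le_pow_right (add_le_add_right hT r) hua)
  refine ⟨monomial (u + ∑ i ∈ U, Finsupp.single i 1) 1, monomial_notMem_of_forall fun i hi => ?_,
    ?_⟩
  · have hiU : i ∉ U := fun h => (Finset.mem_filter.mp h).2 hi
    simp [hu i hi, Finsupp.single_apply, hiU]
  · rw [monomial_mul, one_mul]
    refine monomial_mem_of_le (fun i => ?_) hmem
    simp only [Finsupp.tsub_apply, Finsupp.add_apply, Finsupp.finsetSum_apply,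
      Finsupp.single_apply, Finset.sum_ite_eq']
    by_cases hia : i ∈ a.support <;> by_cases hiP : X i ∈ P <;>
      simp only [T, U, Finset.mem_filter, hia, hiP, not_true_eq_false, not_false_eq_true,
        and_true, and_false, if_true, if_false] <;> omega

theorem symbolicPower_add_le [LinearOrder ι] (hI : IsMonomialIdeal I) {e : ℕ}
    (he : bigHeight I ≤ (e : ℕ∞)) {r : ℕ} (hr : 1 ≤ r) :
    symbolicPower I (r + e) ≤ irrelevantIdeal k ι ^ minSupport I * symbolicPower I r := by
  classical
  intro f hf
  rw [f.as_sum]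
  refine Ideal.sum_mem _ fun a ha => ?_
  rw [← mul_one (coeff a f), ← C_mul_monomial]
  refine Ideal.mul_mem_left _ _ ?_
  have hmem := hI.monomial_mem_symbolicPower hf ha
  -- Here `r ≥ 1` is needed, to get `x^a ∈ I^(1) ⊆ I`.
  have hσ : minSupport I ≤ a.support.card :=
    Nat.sInf_le ⟨a, symbolicPower_one_le I
      (symbolicPower_antitone I (hr.trans (Nat.le_add_right r e)) hmem), rfl⟩
  have hle : ∑ i ∈ a.support, Finsupp.single i 1 ≤ a := fun i => by
    simp only [Finsupp.finsetSum_apply, Finsupp.single_apply, Finset.sum_ite_eq',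
      Finsupp.mem_support_iff]
    split_ifs <;> omega
  rw [← add_tsub_cancel_of_le hle, ← one_mul (1 : k), ← monomial_mul]
  exact Ideal.mul_mem_mul
    (Ideal.pow_le_pow_right hσ (monomial_sum_single_mem_irrelevantIdeal_pow a.support))
    (hI.monomial_sub_support_mem_symbolicPower he hmem)

end SymbolicPower

end SymbolicPowers

theorem mainTheorem9 {k : Type*} [Field k] {n : ℕ}
    (I : Ideal (MvPolynomial (Fin (n + 1)) k)) (hI : SymbolicPowers.IsMonomialIdeal I)
    (e : ℕ) (he : SymbolicPowers.bigHeight I = (e : ℕ∞))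
    (r : ℕ) (hr : 1 ≤ r) :
    SymbolicPowers.symbolicPower I (r + e) ≤
      SymbolicPowers.irrelevantIdeal k (Fin (n + 1)) ^ SymbolicPowers.minSupport I *
        SymbolicPowers.symbolicPower I r := by
  exact SymbolicPowers.symbolicPower_add_le hI he.le hr
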